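/- Let $(\mathbb{M},d)$ be a non-empty compact metric space, let $\mathbb{K}=\mathbb{N}=\{0,1,2,\dots\}$ or $\mathbb{K}=\mathbb{Z}$, let $\sigma:\mathbb{M}^{\mathbb{K}}\to\mathbb{M}^{\mathbb{K}}$, $\sigma((x_k)_k)=(x_{k+1})_k$, be the left shift, and put $$\mathbf{d}(\bar x,\bar y)=\sum_{j\in\mathbb{K}}2^{-|j|}\,d(x_j,y_j),\qquad \bar x=(x_j),\ \bar y=(y_j)\in\mathbb{M}^{\mathbb{K}} .$$ For a compact metric space $(X,\rho)$, $s\ge 0$ and $\varepsilon>0$, let $$\mathrm{H}^s_\varepsilon(X,\rho)=\inf\Big\{\sum_{n=1}^\infty(\operatorname{diam}E_n)^s:\ X=\bigcup_{n=1}^\infty E_n,\ \operatorname{diam}E_n<\varepsilon\text{ for all }n\Big\},$$ with the conventions $0^0=1$ and $(\operatorname{diam}\emptyset)^s=0$, and let $\dim_{\mathrm H}(X,\rho,\varepsilon)=\sup\{s\ge 0:\mathrm{H}^s_\varepsilon(X,\rho)\ge 1\}$. For a continuous map $f:X\to X$ and $n\ge 1$ let $\rho_n(x,y)=\max_{0\le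 i<n}\rho(f^i(x),f^i(y))$. The lower and upper mean Hausdorff dimensions of $(X,\rho,f)$ are $$\underline{\mathrm{mdim}}_{\mathrm H}(X,\rho,f)=\lim_{\varepsilon\to0}\liminf_{n\to\infty}\frac1n\dim_{\mathrm H}(X,\rho_n,\varepsilon),\qquad \overline{\mathrm{mdim}}_{\mathrm H}(X,\rho,f)=\lim_{\varepsilon\to0}\limsup_{n\to\infty}\frac1n\dim_{\mathrm H}(X,\rho_n,\varepsilon).$$ Let $\dim_{\mathrm H}(\mathbb{M},d)$ be the Hausdorff dimension of $(\mathbb{M},d)$, and let $\underline{\dim}_{\mathrm B}(\mathbb{M},d)=\liminf_{\delta\to0}\frac{\log N(\delta)}{-\log\delta}$ be its lower box dimension, where $N(\delta)$ is the smallest number of sets of diameter at most $\delta$ that cover $\mathbb{M}$. All these dimensions take values in $[0,\infty]$. Then $$\dim_{\mathrm H}(\mathbb{M},d)\le\underline{\mathrm{mdim}}_{\mathrm H}(\mathbb{M}^{\mathbb{K}},\mathbf{d},\sigma)\le\overline{\mathrm{mdim}}_{\mathrm H}(\mathbb{M}^{\mathbb{K}},\mathbf{d},\sigma)\le\underline{\dim}_{\mathrm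 B}(\mathbb{M},d).$$ -/

import Mathlib

open Filter Topology MeasureTheory
open scoped ENNReal NNReal

/-! Distances are passed as explicit functions `ρ : X → X → ℝ`, because the sequence space `K → M`
carries, for each `n`, a different distance. -/

namespace MeanHausdorff

/-- The diameter of `E` with respect to `ρ`. -/
noncomputable def setDiam {X : Type*} (ρ : X → X → ℝ) (E : Set X) : ℝ≥0∞ :=
  ⨆ x ∈ E, ⨆ y ∈ E, ENNReal.ofReal (ρ x y)

open Classical in
/-- `(diam E) ^ s`, with the conventions `0 ^ 0 = 1` and `(diam ∅) ^ s = 0`. -/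
noncomputable def diamPow {X : Type*} (ρ : X → X → ℝ) (s : ℝ≥0) (E : Set X) : ℝ≥0∞ :=
  if E = ∅ then 0 else setDiam ρ E ^ (s : ℝ)

/-- `H^s_ε (X, ρ)`: the infimum of `∑ (diam Eₙ) ^ s` over the countable covers `X = ⋃ Eₙ`
with `diam Eₙ < ε` for all `n`. -/
noncomputable def hausdorffContent {X : Type*} (ρ : X → X → ℝ) (s : ℝ≥0) (ε : ℝ) : ℝ≥0∞ :=
  ⨅ (E : ℕ → Set X) (_ : ⋃ n, E n = Set.univ) (_ : ∀ n, setDiam ρ (E n) < ENNReal.ofReal ε),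
    ∑' n, diamPow ρ s (E n)

/-- `dim_H (X, ρ, ε) = sup {s ≥ 0 : H^s_ε (X, ρ) ≥ 1}`. -/
noncomputable def dimHScale {X : Type*} (ρ : X → X → ℝ) (ε : ℝ) : ℝ≥0∞ :=
  ⨆ (s : ℝ≥0) (_ : 1 ≤ hausdorffContent ρ s ε), (s : ℝ≥0∞)

/-- The dynamical distance `dₙ(x, y) = max_{0 ≤ i < n} ρ (fⁱ x, fⁱ y)` (and `0` for `n = 0`). -/
noncomputable def dynDist {X : Type*} (ρ : X → X → ℝ) (f : X → X) (n : ℕ) (x y : X) : ℝ :=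
  ⨆ i : Fin n, ρ (f^[i] x) (f^[i] y)

/-- Lower mean Hausdorff dimension: `lim_{ε → 0} liminf_n (1/n) dim_H (X, dₙ, ε)`. The limit is
monotone, hence a supremum; see `tendsto_lowerMeanDimH`. -/
noncomputable def lowerMeanDimH {X : Type*} (ρ : X → X → ℝ) (f : X → X) : ℝ≥0∞ :=
  ⨆ (ε : ℝ) (_ : 0 < ε), liminf (fun n : ℕ => dimHScale (dynDist ρ f n) ε / n) atTop

/-- Upper mean Hausdorff dimension: `lim_{ε → 0} limsup_n (1/n) dim_H (X, dₙ, ε)`. The limit is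
monotone, hence a supremum; see `tendsto_upperMeanDimH`. -/
noncomputable def upperMeanDimH {X : Type*} (ρ : X → X → ℝ) (f : X → X) : ℝ≥0∞ :=
  ⨆ (ε : ℝ) (_ : 0 < ε), limsup (fun n : ℕ => dimHScale (dynDist ρ f n) ε / n) atTop

/-- The least number of sets of diameter at most `δ` that cover `M`. -/
noncomputable def boxNumber (M : Type*) [MetricSpace M] (δ : ℝ) : ℕ :=
  sInf {m : ℕ | ∃ E : Fin m → Set M,
    ⋃ i, E i = Set.univ ∧ ∀ i, Metric.ediam (E i) ≤ ENNReal.ofReal δ}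

/-- Lower box dimension `liminf_{δ → 0} log N(δ) / (-log δ)`, as an element of `[0, ∞]`. -/
noncomputable def lowerBoxDim (M : Type*) [MetricSpace M] : ℝ≥0∞ :=
  liminf (fun δ : ℝ => ENNReal.ofReal (Real.log (boxNumber M δ) / (-Real.log δ))) (𝓝[>] 0)

/-- The left shift on `M^K`, for `K = ℕ` or `K = ℤ`. -/
def shift {K M : Type*} [Add K] [One K] (x : K → M) : K → M := fun k => x (k + 1)

/-- The distance `∑_{j ∈ ℕ} 2^{-j} d(xⱼ, yⱼ)` on `M^ℕ`. -/
noncomputable def seqDist {M : Type*} [MetricSpace M] (x y : ℕ → M) : ℝ :=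
  ∑' j : ℕ, (1 / 2 ^ j) * dist (x j) (y j)

/-- The distance `∑_{j ∈ ℤ} 2^{-|j|} d(xⱼ, yⱼ)` on `M^ℤ`. -/
noncomputable def biseqDist {M : Type*} [MetricSpace M] (x y : ℤ → M) : ℝ :=
  ∑' j : ℤ, (1 / 2 ^ j.natAbs) * dist (x j) (y j)

/-! The series above converge, and the suprema over `ε` are limits as `ε → 0`. -/

theorem summable_seqDist {M : Type*} [MetricSpace M] [CompactSpace M] (x y : ℕ → M) :
    Summable fun j : ℕ => ((1 : ℝ) / 2 ^ j) * dist (x j) (y j) := by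
  refine Summable.of_nonneg_of_le (fun j => by positivity) (fun j => ?_)
    (summable_geometric_two.mul_right (Metric.diam (Set.univ : Set M)))
  rw [one_div_pow]
  gcongr
  exact Metric.dist_le_diam_of_mem isCompact_univ.isBounded trivial trivial

theorem summable_biseqDist {M : Type*} [MetricSpace M] [CompactSpace M] (x y : ℤ → M) :
    Summable fun j : ℤ => ((1 : ℝ) / 2 ^ j.natAbs) * dist (x j) (y j) := by
  refine Summable.of_nat_of_neg ?_ ?_
  · simpa using summable_seqDist (fun j : ℕ => x j) (fun j : ℕ => y j)
  · simpa using summable_seqDist (fun j : ℕ => x (-j)) (fun j : ℕ => y (-j))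

theorem hausdorffContent_anti {X : Type*} (ρ : X → X → ℝ) (s : ℝ≥0) :
    Antitone (hausdorffContent ρ s) := fun _ _ h =>
  le_iInf fun E => le_iInf fun h1 => le_iInf fun h2 =>
    iInf_le_of_le E <| iInf_le_of_le h1 <|
      iInf_le_of_le (fun n => (h2 n).trans_le (ENNReal.ofReal_le_ofReal h)) le_rfl

theorem dimHScale_anti {X : Type*} (ρ : X → X → ℝ) : Antitone (dimHScale ρ) := fun _ _ h =>
  iSup_le fun s => iSup_le fun hs =>
    le_iSup₂_of_le s (hs.trans (hausdorffContent_anti ρ s h)) le_rfl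

theorem tendsto_iSup_of_antitone {g : ℝ → ℝ≥0∞} (hg : Antitone g) :
    Tendsto g (𝓝[>] 0) (𝓝 (⨆ (ε : ℝ) (_ : 0 < ε), g ε)) := by
  have h := (hg.antitoneOn (Set.Ioi 0)).tendsto_nhdsGT (x := (0 : ℝ)) (OrderTop.bddAbove _)
  rwa [sSup_image] at h

theorem tendsto_lowerMeanDimH {X : Type*} (ρ : X → X → ℝ) (f : X → X) :
    Tendsto (fun ε : ℝ => liminf (fun n : ℕ => dimHScale (dynDist ρ f n) ε / n) atTop)
      (𝓝[>] 0) (𝓝 (lowerMeanDimH ρ f)) :=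
  tendsto_iSup_of_antitone fun _ _ h => liminf_le_liminf <| Eventually.of_forall fun _ =>
    ENNReal.div_le_div_right (dimHScale_anti _ h) _

theorem tendsto_upperMeanDimH {X : Type*} (ρ : X → X → ℝ) (f : X → X) :
    Tendsto (fun ε : ℝ => limsup (fun n : ℕ => dimHScale (dynDist ρ f n) ε / n) atTop)
      (𝓝[>] 0) (𝓝 (upperMeanDimH ρ f)) :=
  tendsto_iSup_of_antitone fun _ _ h => limsup_le_limsup <| Eventually.of_forall fun _ =>
    ENNReal.div_le_div_right (dimHScale_anti _ h) _

/-! The Hausdorff dimension computed from `dimHScale` is Mathlib's `dimH`. -/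

theorem setDiam_dist {M : Type*} [MetricSpace M] (E : Set M) :
    setDiam dist E = Metric.ediam E := by
  simp [setDiam, Metric.ediam, edist_dist]

theorem diamPow_dist {M : Type*} [MetricSpace M] (s : ℝ≥0) (E : Set M) :
    diamPow dist s E = ⨆ _ : E.Nonempty, Metric.ediam E ^ (s : ℝ) := by
  rcases E.eq_empty_or_nonempty with rfl | h
  · simp [diamPow]
  · simp [diamPow, h, h.ne_empty, setDiam_dist]

theorem iSup_dimHScale_eq_dimH (M : Type*) [MetricSpace M] :
    ⨆ (ε : ℝ) (_ : 0 < ε), dimHScale (dist : M → M → ℝ) ε = dimH (Set.univ : Set M) := by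
  borelize M
  apply le_antisymm
  · refine iSup₂_le fun ε hε => iSup₂_le fun s hs => ?_
    by_contra! hlt
    have h0 := hausdorffMeasure_of_dimH_lt hlt
    obtain ⟨r, hr0, hr⟩ := exists_between (ENNReal.ofReal_pos.2 hε)
    rw [Measure.hausdorffMeasure_apply] at h0
    have h1 := ENNReal.iSup_eq_zero.1 (ENNReal.iSup_eq_zero.1 h0 r) hr0
    have : hausdorffContent (dist : M → M → ℝ) s ε ≤ 0 := by
      rw [← h1]
      refine le_iInf fun E => le_iInf fun hE => le_iInf fun hd => ?_
      refine iInf_le_of_le E <| iInf_le_of_le (Set.univ_subset_iff.1 hE) <|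
        iInf_le_of_le (fun n => ?_) ?_
      · rw [setDiam_dist]
        exact (hd n).trans_lt hr
      · simp [diamPow_dist]
    exact absurd (hs.trans this) (by simp)
  · refine dimH_le fun s hs => ?_
    rw [Measure.hausdorffMeasure_apply] at hs
    have h1 : (1 : ℝ≥0∞) < ⊤ := ENNReal.one_lt_top
    rw [← hs] at h1
    obtain ⟨r, h1⟩ := lt_iSup_iff.1 h1
    obtain ⟨hr, h1⟩ := lt_iSup_iff.1 h1
    obtain ⟨ε, hε0, hε⟩ : ∃ ε : ℝ, 0 < ε ∧ ENNReal.ofReal ε ≤ r := by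
      rcases eq_or_ne r ⊤ with rfl | h
      · exact ⟨1, one_pos, le_top⟩
      · exact ⟨r.toReal, ENNReal.toReal_pos hr.ne' h, by rw [ENNReal.ofReal_toReal h]⟩
    refine le_iSup₂_of_le ε hε0 (le_iSup₂_of_le s (h1.le.trans ?_) le_rfl)
    refine le_iInf fun E => le_iInf fun hE => le_iInf fun hd => ?_
    refine iInf_le_of_le E <| iInf_le_of_le hE.ge <| iInf_le_of_le (fun n => ?_) ?_
    · rw [← setDiam_dist]
      exact (hd n).le.trans hε
    · simp [diamPow_dist]

end MeanHausdorff

/-! For the lower bound, a set of small diameter in `M ^ n` lies in a product of `n` balls of the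
same radius `r`. Fixing all coordinates but one turns a cover by such products, of cost
`∑ r ^ (n * s)`, into a weighted cover of `M` by balls, and a Frostman measure on `M` would bound
the cost of weighted covers from below. An elementary argument replaces this measure: if every
cover selected from a finite family of balls contains disjoint balls of cost at least `A` (Vitali),
then lowering the weights along such disjoint balls, step by step, shows that every weighted cover
by balls of the family costs at least `A`; and this property is multiplicative over products.
Reading off the `0`-th coordinate along the orbit of `x` is then a map to `M ^ n` that shrinks
`dₙ`, up to a constant, to the sup distance.

For the upper bound, up to a tail of size `δ` the distance depends on finitely many coordinates
`S`, so `dₙ` depends on the coordinates in `S + {0, …, n - 1}`, of which there are `n + O(1)`.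
Products of an optimal cover of `M` by sets of diameter at most `δ` form `N(δ) ^ (n + O(1))` sets
of `dₙ`-diameter at most `C * δ`, and `log (C * δ) / log δ` tends to `1`. -/

namespace MeanHausdorff

section Content

variable {X Y : Type*} {ρ : X → X → ℝ}

theorem diamPow_empty (s : ℝ≥0) : diamPow ρ s (∅ : Set X) = 0 := by simp [diamPow]

theorem diamPow_of_nonempty (s : ℝ≥0) {E : Set X} (hE : E.Nonempty) :
    diamPow ρ s E = setDiam ρ E ^ (s : ℝ) := by
  simp [diamPow, hE.ne_empty]

theorem diamPow_le (s : ℝ≥0) (E : Set X) : diamPow ρ s E ≤ setDiam ρ E ^ (s : ℝ) := by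
  unfold diamPow
  split_ifs <;> simp

theorem setDiam_le {E : Set X} {r : ℝ} (h : ∀ x ∈ E, ∀ y ∈ E, ρ x y ≤ r) :
    setDiam ρ E ≤ ENNReal.ofReal r :=
  iSup₂_le fun x hx => iSup₂_le fun y hy => ENNReal.ofReal_le_ofReal (h x hx y hy)

theorem ofReal_le_setDiam {E : Set X} {x y : X} (hx : x ∈ E) (hy : y ∈ E) :
    ENNReal.ofReal (ρ x y) ≤ setDiam ρ E :=
  le_iSup₂_of_le x hx (le_iSup₂_of_le y hy le_rfl)

theorem hausdorffContent_le_tsum {ι : Type*} [Countable ι] (s : ℝ≥0) {ε : ℝ} (hε : 0 < ε)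
    (E : ι → Set X) (hE : ⋃ i, E i = Set.univ) (hd : ∀ i, setDiam ρ (E i) < ENNReal.ofReal ε) :
    hausdorffContent ρ s ε ≤ ∑' i, diamPow ρ s (E i) := by
  obtain ⟨_⟩ := nonempty_encodable ι
  refine iInf_le_of_le (fun n => ⋃ b ∈ Encodable.decode₂ ι n, E b) <|
    iInf_le_of_le ((Encodable.iUnion_decode₂ E).trans hE) <| iInf_le_of_le (fun n => ?_) ?_
  · refine Encodable.iUnion_decode₂_cases
      (C := fun A => setDiam ρ A < ENNReal.ofReal ε) ?_ hd
    simpa [setDiam] using hε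
  · rw [tsum_iUnion_decode₂ (diamPow ρ s) (diamPow_empty s) E]

theorem mul_setDiam_image_le {ρY : Y → Y → ℝ} {g : X → Y} {c : ℝ≥0}
    (h : ∀ x y, c * ρY (g x) (g y) ≤ ρ x y) (E : Set X) :
    c * setDiam ρY (g '' E) ≤ setDiam ρ E := by
  simp only [setDiam, iSup_image, ENNReal.mul_iSup]
  refine iSup₂_le fun x hx => iSup₂_le fun y hy => ?_
  rw [← ENNReal.ofReal_coe_nnreal, ← ENNReal.ofReal_mul c.coe_nonneg]
  exact (ENNReal.ofReal_le_ofReal (h x y)).trans (ofReal_le_setDiam hx hy)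

theorem rpow_mul_hausdorffContent_le {ρY : Y → Y → ℝ} {g : X → Y} (hg : Function.Surjective g)
    {c : ℝ≥0} (h : ∀ x y, c * ρY (g x) (g y) ≤ ρ x y) (s : ℝ≥0) (ε : ℝ) :
    (c : ℝ≥0∞) ^ (s : ℝ) * hausdorffContent ρY s ε ≤ hausdorffContent ρ s (c * ε) := by
  refine le_iInf fun E => le_iInf fun hE => le_iInf fun hd => ?_
  have hcover : ⋃ n, g '' E n = Set.univ := by
    rw [← Set.image_iUnion, hE, Set.image_univ_of_surjective hg]
  have hdiam : ∀ n, setDiam ρY (g '' E n) < ENNReal.ofReal ε := fun n => by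
    have := (mul_setDiam_image_le h (E n)).trans_lt (hd n)
    rw [ENNReal.ofReal_mul c.coe_nonneg, ENNReal.ofReal_coe_nnreal] at this
    exact lt_of_mul_lt_mul_left' this
  have hpow : ∀ n, (c : ℝ≥0∞) ^ (s : ℝ) * diamPow ρY s (g '' E n) ≤ diamPow ρ s (E n) := by
    intro n
    rcases (E n).eq_empty_or_nonempty with hn | hn
    · simp [hn, diamPow_empty]
    · rw [diamPow_of_nonempty s hn, diamPow_of_nonempty s (hn.image g),
        ← ENNReal.mul_rpow_of_nonneg _ _ s.coe_nonneg]
      exact ENNReal.rpow_le_rpow (mul_setDiam_image_le h (E n)) s.coe_nonneg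
  calc (c : ℝ≥0∞) ^ (s : ℝ) * hausdorffContent ρY s ε
      ≤ c ^ (s : ℝ) * ∑' n, diamPow ρY s (g '' E n) := by
        gcongr
        exact iInf_le_of_le _ <| iInf_le_of_le hcover <| iInf_le _ hdiam
    _ ≤ ∑' n, diamPow ρ s (E n) := by
        rw [← ENNReal.tsum_mul_left]
        exact ENNReal.tsum_le_tsum hpow

end Content

section MetricContent

variable {M : Type*} [MetricSpace M]

theorem hausdorffMeasure_univ_le_iSup_hausdorffContent [MeasurableSpace M] [BorelSpace M]
    (s : ℝ≥0) :
    Measure.hausdorffMeasure (s : ℝ) (Set.univ : Set M) ≤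
      ⨆ (ε : ℝ) (_ : 0 < ε), hausdorffContent (dist : M → M → ℝ) s ε := by
  rw [Measure.hausdorffMeasure_apply]
  refine iSup₂_le fun r hr => ?_
  obtain ⟨ε, hε0, hεr⟩ := ENNReal.lt_iff_exists_nnreal_btwn.1 hr
  refine le_iSup₂_of_le (ε : ℝ) (by exact_mod_cast hε0) ?_
  refine le_iInf fun E => le_iInf fun hE => le_iInf fun hd => ?_
  refine iInf_le_of_le E <| iInf_le_of_le hE.ge <| iInf_le_of_le (fun n => ?_) ?_
  · rw [← setDiam_dist]
    exact ((hd n).trans_le (by rw [ENNReal.ofReal_coe_nnreal])).le.trans hεr.le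
  · simp only [diamPow_dist, le_refl]

theorem exists_le_hausdorffContent {s : ℝ≥0} (hs : (s : ℝ≥0∞) < dimH (Set.univ : Set M))
    {A : ℝ≥0∞} (hA : A < ⊤) :
    ∃ ε : ℝ, 0 < ε ∧ A ≤ hausdorffContent (dist : M → M → ℝ) s ε := by
  borelize M
  have hlt := hA.trans_le <| (hausdorffMeasure_of_lt_dimH hs).symm.trans_le
    (hausdorffMeasure_univ_le_iSup_hausdorffContent s)
  obtain ⟨ε, hε, hlt⟩ : ∃ ε, ∃ _ : 0 < ε, A < hausdorffContent (dist : M → M → ℝ) s ε := by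
    simpa only [lt_iSup_iff] using hlt
  exact ⟨ε, hε, hlt.le⟩

theorem exists_subset_ball_rpow_le (s : ℝ≥0) {ε : ℝ} {E : Set M} (hE : E.Nonempty)
    (hd : Metric.ediam E < ENNReal.ofReal ε) {δ : ℝ≥0∞} (hδ : δ ≠ 0) :
    ∃ (x : M) (r : ℝ≥0), r < ε ∧ E ⊆ Metric.ball x r ∧
      (r : ℝ≥0∞) ^ (s : ℝ) ≤ Metric.ediam E ^ (s : ℝ) + δ := by
  have hpow : ∀ᶠ t in 𝓝[>] Metric.ediam E, t ^ (s : ℝ) < Metric.ediam E ^ (s : ℝ) + δ :=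
    (ENNReal.continuous_rpow_const.tendsto _ |>.mono_left nhdsWithin_le_nhds).eventually_lt_const
      (ENNReal.lt_add_right (ENNReal.rpow_ne_top_of_nonneg s.coe_nonneg hd.ne_top) hδ)
  have : (𝓝[>] Metric.ediam E).NeBot := nhdsGT_neBot_of_exists_gt ⟨_, hd⟩
  obtain ⟨t, ht, hdt, htε⟩ := (hpow.and (Ioo_mem_nhdsGT hd)).exists
  lift t to ℝ≥0 using htε.ne_top
  obtain ⟨x, hx⟩ := hE
  refine ⟨x, t, by simpa using (ENNReal.lt_ofReal_iff_toReal_lt ENNReal.coe_ne_top).1 htε,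
    fun y hy => ?_, ht.le⟩
  rw [← Metric.eball_coe, Metric.mem_eball]
  exact (Metric.edist_le_ediam_of_mem hy hx).trans_lt hdt

theorem le_hausdorffContent_of_forall_closedBall [CompactSpace M] {s : ℝ≥0} {ε : ℝ} {b : ℝ≥0∞}
    (h : ∀ (κ : Type) [Fintype κ] (x : κ → M) (r : κ → ℝ≥0), (∀ k, r k < ε) →
      (∀ y, ∃ k, y ∈ Metric.closedBall (x k) (r k)) → b ≤ ∑ k, (r k : ℝ≥0∞) ^ (s : ℝ)) :
    b ≤ hausdorffContent (dist : M → M → ℝ) s ε := by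
  refine le_iInf fun E => le_iInf fun hE => le_iInf fun hd => ?_
  refine ENNReal.le_of_forall_pos_le_add fun η hη _ => ?_
  obtain ⟨δ, hδ, hδη⟩ := ENNReal.exists_pos_sum_of_countable (ENNReal.coe_pos.2 hη).ne'
    {n : ℕ // (E n).Nonempty}
  choose x r hr hsub hpow using fun n : {n // (E n).Nonempty} =>
    exists_subset_ball_rpow_le s n.2 ((setDiam_dist (E n)).symm.trans_lt (hd n))
      (ENNReal.coe_pos.2 (hδ n)).ne'
  obtain ⟨F, hF⟩ := isCompact_univ.elim_finite_subcover (fun n => Metric.ball (x n) (r n))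
    (fun _ => Metric.isOpen_ball) fun y _ => by
      obtain ⟨n, hn⟩ := Set.mem_iUnion.1 (hE.ge (Set.mem_univ y))
      exact Set.mem_iUnion.2 ⟨⟨n, y, hn⟩, hsub _ hn⟩
  calc b ≤ ∑ n : F, (r n : ℝ≥0∞) ^ (s : ℝ) := by
        refine h F (fun n => x n) (fun n => r n) (fun n => hr n) fun y => ?_
        obtain ⟨n, hn, hy⟩ := Set.mem_iUnion₂.1 (hF (Set.mem_univ y))
        exact ⟨⟨n, hn⟩, Metric.ball_subset_closedBall hy⟩
    _ = ∑ n ∈ F, (r n : ℝ≥0∞) ^ (s : ℝ) := Finset.sum_coe_sort F fun n => (r n : ℝ≥0∞) ^ (s : ℝ)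
    _ ≤ ∑' n, (r n : ℝ≥0∞) ^ (s : ℝ) := ENNReal.sum_le_tsum F
    _ ≤ ∑' n : {n // (E n).Nonempty}, (diamPow dist s (E n) + δ n) :=
        ENNReal.tsum_le_tsum fun n => by
          rw [diamPow_of_nonempty s n.2, setDiam_dist]
          exact hpow n
    _ ≤ ∑' n, diamPow dist s (E n) + η := by
        rw [ENNReal.tsum_add]
        gcongr
        exact ENNReal.tsum_comp_le_tsum_of_injective Subtype.val_injective _

end MetricContent

section FractionalCover

variable {κ Y : Type*}

theorem sum_indicator_one_le_one {B : κ → Set Y} {G : Finset κ}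
    (hG : (G : Set κ).PairwiseDisjoint B) (y : Y) :
    ∑ k ∈ G, (B k).indicator (1 : Y → ℝ≥0) y ≤ 1 := by
  rw [← Finset.indicator_biUnion_apply G B hG]
  exact Set.indicator_le_self' (fun _ _ => zero_le_one) y

variable [Fintype κ]

open Classical in
theorem exists_eq_add_ite_and_support_ssubset (c : κ → ℝ≥0) {G : Finset κ} (hne : G.Nonempty)
    (hG : ∀ k ∈ G, c k ≠ 0) :
    ∃ (t : ℝ≥0) (c' : κ → ℝ≥0), (∀ k, c k = c' k + if k ∈ G then t else 0) ∧
      ({k | c' k ≠ 0} : Finset κ) ⊂ ({k | c k ≠ 0} : Finset κ) := by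
  obtain ⟨k₀, hk₀, hmin⟩ := G.exists_min_image c hne
  refine ⟨c k₀, fun k => c k - if k ∈ G then c k₀ else 0, fun k => ?_, ?_⟩
  · refine (tsub_add_cancel_of_le ?_).symm
    split_ifs with hk
    · exact hmin k hk
    · exact zero_le
  · refine (Finset.ssubset_iff_of_subset fun k hk => ?_).2
      ⟨k₀, by simpa using hG k₀ hk₀, by simp [hk₀]⟩
    rw [Finset.mem_filter_univ] at hk ⊢
    exact fun h0 => hk (by simp [h0])

/-- Every family of coefficients `c` for which `∑ c k * φ k ≥ m` everywhere has total cost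
`∑ c k * w k ≥ m * A`. By linear programming duality this plays the role of a measure of mass `A`
giving each `φ k` integral at most `w k`. It is stated for all `m`, and not only for `m = 1`, so
that it can be iterated over the factors of a product. -/
def FractionalCoverBound (φ : κ → Y → ℝ≥0) (w : κ → ℝ≥0) (A : ℝ≥0) : Prop :=
  ∀ (c : κ → ℝ≥0) (m : ℝ≥0), (∀ y, m ≤ ∑ k, c k * φ k y) → m * A ≤ ∑ k, c k * w k

/-- Greedy argument: lower all coefficients of a disjoint subfamily of the support by the least of
them. The threshold drops by at most this amount, and the support shrinks. -/
theorem fractionalCoverBound_of_exists_pairwiseDisjoint {B : κ → Set Y} {w : κ → ℝ≥0} {A : ℝ≥0}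
    (h : ∀ F : Finset κ, (∀ y, ∃ k ∈ F, y ∈ B k) →
      ∃ G ⊆ F, (G : Set κ).PairwiseDisjoint B ∧ A ≤ ∑ k ∈ G, w k) :
    FractionalCoverBound (fun k => (B k).indicator 1) w A := by
  classical
  intro c m hm
  induction hF : ({k | c k ≠ 0} : Finset κ) using Finset.strongInduction generalizing c m with
  | H F ih =>
  subst hF
  rcases eq_or_ne m 0 with rfl | hm0
  · simp
  obtain ⟨G, hGF, hdisj, hA⟩ := h {k | c k ≠ 0} fun y => by
    obtain ⟨k, -, hk⟩ := Finset.exists_ne_zero_of_sum_ne_zero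
      ((pos_iff_ne_zero.2 hm0).trans_le (hm y)).ne'
    exact ⟨k, by simpa using left_ne_zero_of_mul hk,
      Set.mem_of_indicator_ne_zero (right_ne_zero_of_mul hk)⟩
  rcases G.eq_empty_or_nonempty with rfl | hne
  · simp [show A = 0 by simpa using hA]
  obtain ⟨t, c', hc', hsupp⟩ := exists_eq_add_ite_and_support_ssubset c hne
    fun k hk => by simpa using hGF hk
  have hsplit : ∀ v : κ → ℝ≥0, ∑ k, c k * v k = ∑ k, c' k * v k + t * ∑ k ∈ G, v k := fun v => by
    simp only [hc', add_mul, ite_mul, zero_mul, Finset.sum_add_distrib, Finset.sum_ite_mem,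
      Finset.univ_inter, Finset.mul_sum]
  have hm' : ∀ y, m - t ≤ ∑ k, c' k * (B k).indicator 1 y := fun y => by
    rw [tsub_le_iff_right]
    calc m ≤ ∑ k, c' k * (B k).indicator 1 y + t * ∑ k ∈ G, (B k).indicator 1 y :=
          (hm y).trans_eq (hsplit fun k => (B k).indicator 1 y)
      _ ≤ ∑ k, c' k * (B k).indicator 1 y + t := by
          gcongr
          exact mul_le_of_le_one_right' (sum_indicator_one_le_one hdisj y)
  calc m * A ≤ (m - t) * A + t * A := by
        rw [← add_mul]
        gcongr
        exact le_tsub_add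
    _ ≤ ∑ k, c' k * w k + t * ∑ k ∈ G, w k := by
        gcongr
        exact ih _ hsupp c' (m - t) hm' rfl
    _ = ∑ k, c k * w k := (hsplit w).symm

theorem FractionalCoverBound.pi {n : ℕ} {Y : Fin n → Type*} {φ : ∀ i, κ → Y i → ℝ≥0}
    {w : Fin n → κ → ℝ≥0} {A : Fin n → ℝ≥0} (h : ∀ i, FractionalCoverBound (φ i) (w i) (A i)) :
    FractionalCoverBound (fun k (y : ∀ i, Y i) => ∏ i, φ i k (y i)) (fun k => ∏ i, w i k)
      (∏ i, A i) := by
  induction n with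
  | zero => exact fun c m hm => by simpa using hm finZeroElim
  | succ n ih =>
    intro c m hm
    have hsection : ∀ y₀, m * ∏ i : Fin n, A i.succ ≤
        ∑ k, (c k * ∏ i : Fin n, w i.succ k) * φ 0 k y₀ := fun y₀ => by
      simpa only [mul_right_comm] using
        ih (fun i => h i.succ) (fun k => c k * φ 0 k y₀) m fun y => by
          simpa [Fin.prod_univ_succ, mul_assoc] using hm (Fin.cons y₀ y)
    simpa only [Fin.prod_univ_succ, mul_assoc, mul_comm, mul_left_comm] using
      h 0 _ _ hsection

end FractionalCover

section Product

variable {M : Type*} [MetricSpace M] {s : ℝ≥0} {ε : ℝ} {A : ℝ≥0}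

theorem hausdorffContent_le_sum_closedBall {ι : Type*} [Fintype ι] (s : ℝ≥0) (hε : 0 < ε)
    {x : ι → M} {r : ι → ℝ≥0} (hr : ∀ i, 2 * r i < ε)
    (hcover : ⋃ i, Metric.closedBall (x i) (r i) = Set.univ) :
    hausdorffContent (dist : M → M → ℝ) s ε ≤ ∑ i, (2 * r i : ℝ≥0∞) ^ (s : ℝ) := by
  have hdiam : ∀ i, setDiam dist (Metric.closedBall (x i) (r i)) ≤ 2 * r i := fun i => by
    rw [setDiam_dist, ← Metric.closedEBall_coe]
    exact Metric.ediam_closedEBall_le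
  calc hausdorffContent dist s ε
      ≤ ∑' i, diamPow dist s (Metric.closedBall (x i) (r i)) :=
        hausdorffContent_le_tsum s hε _ hcover fun i => (hdiam i).trans_lt <|
          (ENNReal.lt_ofReal_iff_toReal_lt (by finiteness)).2 (by simpa using hr i)
    _ = ∑ i, diamPow dist s (Metric.closedBall (x i) (r i)) := tsum_fintype _
    _ ≤ ∑ i, (2 * r i : ℝ≥0∞) ^ (s : ℝ) := Finset.sum_le_sum fun i _ =>
        (diamPow_le s _).trans (ENNReal.rpow_le_rpow (hdiam i) s.coe_nonneg)

/-- The `10` is twice the enlargement factor `5` in Vitali's covering lemma. -/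
theorem exists_pairwiseDisjoint_closedBall_le_sum {κ : Type*} (hε : 0 < ε)
    (hA : 10 ^ (s : ℝ) * (A : ℝ≥0∞) ≤ hausdorffContent (dist : M → M → ℝ) s ε)
    {x : κ → M} {r : κ → ℝ≥0} (hr : ∀ k, 10 * r k < ε) {F : Finset κ}
    (hF : ∀ y, ∃ k ∈ F, y ∈ Metric.closedBall (x k) (r k)) :
    ∃ G ⊆ F, (G : Set κ).PairwiseDisjoint (fun k => Metric.closedBall (x k) (r k)) ∧
      A ≤ ∑ k ∈ G, r k ^ (s : ℝ) := by
  obtain ⟨G, hGF, hdisj, hG⟩ := Vitali.exists_disjoint_subfamily_covering_enlargement_closedBall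
    (F : Set κ) x (fun k => r k) (ε / 10) (fun k _ => by linarith [hr k]) 5 (by norm_num)
  lift G to Finset κ using F.finite_toSet.subset hGF
  refine ⟨G, by exact_mod_cast hGF, hdisj, ?_⟩
  have hcover : ⋃ k : G, Metric.closedBall (x k) ((5 * r k : ℝ≥0) : ℝ) = Set.univ := by
    refine Set.eq_univ_of_forall fun y => ?_
    obtain ⟨k, hk, hy⟩ := hF y
    obtain ⟨l, hl, hkl⟩ := hG k hk
    exact Set.mem_iUnion.2 ⟨⟨l, hl⟩, by simpa using hkl hy⟩
  have hsum : (10 : ℝ≥0∞) ^ (s : ℝ) * A ≤ 10 ^ (s : ℝ) * ∑ k ∈ G, (r k : ℝ≥0∞) ^ (s : ℝ) :=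
    calc 10 ^ (s : ℝ) * (A : ℝ≥0∞)
        ≤ ∑ k : G, (2 * (5 * r k : ℝ≥0) : ℝ≥0∞) ^ (s : ℝ) :=
          hA.trans <| hausdorffContent_le_sum_closedBall s hε
            (fun k => by push_cast; linarith [hr k]) hcover
      _ = ∑ k ∈ G, (2 * (5 * r k : ℝ≥0) : ℝ≥0∞) ^ (s : ℝ) :=
          Finset.sum_coe_sort G fun k => (2 * (5 * r k : ℝ≥0) : ℝ≥0∞) ^ (s : ℝ)
      _ = 10 ^ (s : ℝ) * ∑ k ∈ G, (r k : ℝ≥0∞) ^ (s : ℝ) := by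
          simp_rw [Finset.mul_sum, ← ENNReal.mul_rpow_of_nonneg _ _ s.coe_nonneg,
            ENNReal.coe_mul, ← mul_assoc]
          norm_num
  rw [ENNReal.mul_le_mul_iff_right (by simp) (by simp)] at hsum
  simpa only [← ENNReal.coe_rpow_of_nonneg _ s.coe_nonneg, ← ENNReal.ofNNReal_finsetSum,
    ENNReal.coe_le_coe] using hsum

theorem fractionalCoverBound_closedBall {κ : Type*} [Fintype κ] (hε : 0 < ε)
    (hA : 10 ^ (s : ℝ) * (A : ℝ≥0∞) ≤ hausdorffContent (dist : M → M → ℝ) s ε)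
    (x : κ → M) {r : κ → ℝ≥0} (hr : ∀ k, 10 * r k < ε) :
    FractionalCoverBound (fun k => (Metric.closedBall (x k) (r k)).indicator 1)
      (fun k => r k ^ (s : ℝ)) A :=
  fractionalCoverBound_of_exists_pairwiseDisjoint fun _ =>
    exists_pairwiseDisjoint_closedBall_le_sum hε hA hr

theorem pow_le_hausdorffContent_pi [CompactSpace M] (hε : 0 < ε)
    (hA : 10 ^ (s : ℝ) * (A : ℝ≥0∞) ≤ hausdorffContent (dist : M → M → ℝ) s ε) (n : ℕ) :
    (A : ℝ≥0∞) ^ n ≤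
      hausdorffContent (dist : (Fin n → M) → (Fin n → M) → ℝ) (n * s) (ε / 10) := by
  refine le_hausdorffContent_of_forall_closedBall fun κ _ x r hr hcover => ?_
  have hr10 : ∀ k, 10 * r k < ε := fun k => by linarith [hr k]
  have hbound := FractionalCoverBound.pi
    (fun i : Fin n => fractionalCoverBound_closedBall hε hA (fun k => x k i) hr10) 1 1 fun y => by
      obtain ⟨k, hk⟩ := hcover y
      rw [closedBall_pi _ (r k).coe_nonneg, Set.mem_univ_pi] at hk
      refine le_trans ?_ (Finset.single_le_sum (fun _ _ => zero_le) (Finset.mem_univ k))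
      simp [hk]
  have hpow : ∀ k, r k ^ ((n * s : ℝ≥0) : ℝ) = (r k ^ (s : ℝ)) ^ n := fun k => by
    rw [NNReal.coe_mul, NNReal.coe_natCast, mul_comm, NNReal.rpow_mul, NNReal.rpow_natCast]
  simp_rw [← ENNReal.coe_rpow_of_nonneg _ (n * s).coe_nonneg, hpow]
  exact_mod_cast (by simpa using hbound : A ^ n ≤ ∑ k, (r k ^ (s : ℝ)) ^ n)

end Product

section LowerBound

theorem le_dynDist {X : Type*} (ρ : X → X → ℝ) (f : X → X) {n : ℕ} (i : Fin n) (x y : X) :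
    ρ (f^[i] x) (f^[i] y) ≤ dynDist ρ f n x y :=
  le_ciSup (f := fun i : Fin n => ρ (f^[i] x) (f^[i] y)) (Set.finite_range _).bddAbove i

variable {M X : Type*} [MetricSpace M] {ρ : X → X → ℝ} {f : X → X} {c : ℝ≥0} {p : X → M}

theorem mul_dist_itinerary_le_dynDist (hc : 0 < c) (hp : ∀ x y, c * dist (p x) (p y) ≤ ρ x y)
    (n : ℕ) (x y : X) :
    c * dist (fun i : Fin n => p (f^[i] x)) (fun i => p (f^[i] y)) ≤ dynDist ρ f n x y := by
  have hc' : (0 : ℝ) < c := hc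
  have hnonneg : 0 ≤ dynDist ρ f n x y := Real.iSup_nonneg fun i =>
    (by positivity : (0 : ℝ) ≤ c * dist (p (f^[i] x)) (p (f^[i] y))).trans (hp _ _)
  rw [← le_div_iff₀' hc', dist_pi_le_iff (by positivity)]
  intro i
  rw [le_div_iff₀' hc']
  exact (hp _ _).trans (le_dynDist ρ f i x y)

theorem dimH_le_lowerMeanDimH [CompactSpace M] (hc : 0 < c)
    (hp : ∀ x y, c * dist (p x) (p y) ≤ ρ x y)
    (hsurj : ∀ n, Function.Surjective fun x (i : Fin n) => p (f^[i] x)) :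
    dimH (Set.univ : Set M) ≤ lowerMeanDimH ρ f := by
  refine ENNReal.le_of_forall_nnreal_lt fun s hs => ?_
  obtain ⟨ε, hε, hA⟩ := exists_le_hausdorffContent hs
    (A := 10 ^ (s : ℝ) * ((c ^ (s : ℝ))⁻¹ : ℝ≥0)) (by finiteness)
  have hone : ∀ n : ℕ, 1 ≤ hausdorffContent (dynDist ρ f n) (n * s) (c * (ε / 10)) := fun n =>
    calc (1 : ℝ≥0∞) = (c : ℝ≥0∞) ^ ((n * s : ℝ≥0) : ℝ) * ((c ^ (s : ℝ))⁻¹ : ℝ≥0) ^ n := by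
          rw [NNReal.coe_mul, NNReal.coe_natCast, mul_comm (n : ℝ), ENNReal.rpow_mul,
            ENNReal.rpow_natCast, ← mul_pow, ← ENNReal.coe_rpow_of_nonneg _ s.coe_nonneg,
            ← ENNReal.coe_mul, mul_inv_cancel₀ (NNReal.rpow_pos hc).ne', ENNReal.coe_one, one_pow]
      _ ≤ c ^ ((n * s : ℝ≥0) : ℝ) *
            hausdorffContent (dist : (Fin n → M) → (Fin n → M) → ℝ) (n * s) (ε / 10) := by
          gcongr
          exact pow_le_hausdorffContent_pi hε hA n
      _ ≤ _ := rpow_mul_hausdorffContent_le (hsurj n) (mul_dist_itinerary_le_dynDist hc hp n) _ _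
  refine le_iSup₂_of_le (c * (ε / 10)) (by positivity) (le_liminf_of_le (by isBoundedDefault) ?_)
  filter_upwards [eventually_ne_atTop 0] with n hn
  rw [ENNReal.le_div_iff_mul_le (by simp [hn]) (by simp)]
  refine le_iSup₂_of_le ((n : ℝ≥0) * s) (hone n) ?_
  rw [ENNReal.coe_mul, ENNReal.coe_natCast, mul_comm]

end LowerBound

section UpperBound

theorem hausdorffContent_le_card_mul {X ι : Type*} [Fintype ι] {ρ : X → X → ℝ} (s : ℝ≥0)
    {r ε : ℝ} (hε : 0 < ε) (hrε : r < ε) (E : ι → Set X) (hE : ⋃ i, E i = Set.univ)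
    (hd : ∀ i, ∀ x ∈ E i, ∀ y ∈ E i, ρ x y ≤ r) :
    hausdorffContent ρ s ε ≤ Fintype.card ι * ENNReal.ofReal r ^ (s : ℝ) := by
  have hdiam : ∀ i, setDiam ρ (E i) ≤ ENNReal.ofReal r := fun i => setDiam_le (hd i)
  calc hausdorffContent ρ s ε
      ≤ ∑' i, diamPow ρ s (E i) := hausdorffContent_le_tsum s hε E hE fun i =>
        (hdiam i).trans_lt ((ENNReal.ofReal_lt_ofReal_iff hε).2 hrε)
    _ ≤ ∑' _ : ι, ENNReal.ofReal r ^ (s : ℝ) := ENNReal.tsum_le_tsum fun i =>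
        (diamPow_le s _).trans (ENNReal.rpow_le_rpow (hdiam i) s.coe_nonneg)
    _ = Fintype.card ι * ENNReal.ofReal r ^ (s : ℝ) := by simp [tsum_fintype]

theorem dimHScale_le_of_cover {X ι : Type*} [Fintype ι] {ρ : X → X → ℝ} {r ε : ℝ} (hr0 : 0 < r)
    (hr1 : r < 1) (hrε : r < ε) (E : ι → Set X) (hE : ⋃ i, E i = Set.univ)
    (hd : ∀ i, ∀ x ∈ E i, ∀ y ∈ E i, ρ x y ≤ r) :
    dimHScale ρ ε ≤ ENNReal.ofReal (Real.log (Fintype.card ι) / -Real.log r) := by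
  refine iSup₂_le fun s hs => ?_
  have hone : 1 ≤ Fintype.card ι * r ^ (s : ℝ) := by
    have := hs.trans (hausdorffContent_le_card_mul s (hr0.trans hrε) hrε E hE hd)
    rwa [ENNReal.ofReal_rpow_of_pos hr0, ← ENNReal.ofReal_natCast,
      ← ENNReal.ofReal_mul (Nat.cast_nonneg _), ENNReal.one_le_ofReal] at this
  have hcard : (Fintype.card ι : ℝ) ≠ 0 := left_ne_zero_of_mul (one_pos.trans_le hone).ne'
  have hlog : 0 ≤ Real.log (Fintype.card ι) + s * Real.log r := by
    rw [← Real.log_rpow hr0, ← Real.log_mul hcard (Real.rpow_pos_of_pos hr0 _).ne']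
    exact Real.log_nonneg hone
  rw [← ENNReal.ofReal_coe_nnreal]
  refine ENNReal.ofReal_le_ofReal ?_
  rw [le_div_iff₀ (neg_pos.2 (Real.log_neg hr0 hr1))]
  linarith

variable {M : Type*} [MetricSpace M]

theorem exists_cover_boxNumber [CompactSpace M] {δ : ℝ} (hδ : 0 < δ) :
    ∃ E : Fin (boxNumber M δ) → Set M,
      ⋃ i, E i = Set.univ ∧ ∀ i, Metric.ediam (E i) ≤ ENNReal.ofReal δ := by
  refine Nat.sInf_mem (s := {m : ℕ | ∃ E : Fin m → Set M,
    ⋃ i, E i = Set.univ ∧ ∀ i, Metric.ediam (E i) ≤ ENNReal.ofReal δ}) ?_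
  obtain ⟨t, -, ht, hcover⟩ := finite_cover_balls_of_compact (isCompact_univ (X := M))
    (half_pos hδ)
  lift t to Finset M using ht
  refine ⟨t.card, fun i => Metric.ball (t.equivFin.symm i) (δ / 2),
    Set.eq_univ_of_forall fun x => ?_, fun i => ?_⟩
  · obtain ⟨c, hc, hx⟩ := Set.mem_iUnion₂.1 (hcover (Set.mem_univ x))
    exact Set.mem_iUnion.2 ⟨t.equivFin ⟨c, hc⟩, by simpa using hx⟩
  · rw [← setDiam_dist]
    refine setDiam_le fun x hx y hy => ?_
    linarith [dist_triangle_right x y (t.equivFin.symm i), Metric.mem_ball.1 hx,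
      Metric.mem_ball.1 hy]

theorem dimHScale_le_card_mul_boxNumber [CompactSpace M] {X T : Type*} [Fintype T] {ρ : X → X → ℝ}
    (q : X → T → M) {δ r ε : ℝ} (hδ : 0 < δ) (hr0 : 0 < r) (hr1 : r < 1) (hrε : r < ε)
    (hq : ∀ x y, (∀ t, dist (q x t) (q y t) ≤ δ) → ρ x y ≤ r) :
    dimHScale ρ ε ≤
      Fintype.card T * ENNReal.ofReal (Real.log (boxNumber M δ) / -Real.log r) := by
  classical
  obtain ⟨E, hE, hd⟩ := exists_cover_boxNumber (M := M) hδ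
  have hcover : ⋃ u : T → Fin (boxNumber M δ), {x | ∀ t, q x t ∈ E (u t)} = Set.univ := by
    refine Set.eq_univ_of_forall fun x => ?_
    choose u hu using fun t => Set.mem_iUnion.1 (hE.ge (Set.mem_univ (q x t)))
    exact Set.mem_iUnion.2 ⟨u, hu⟩
  refine (dimHScale_le_of_cover hr0 hr1 hrε _ hcover fun u x hx y hy => hq x y fun t => ?_).trans_eq
    ?_
  · rw [← ENNReal.ofReal_le_ofReal_iff hδ.le, ← edist_dist]
    exact (Metric.edist_le_ediam_of_mem (hx t) (hy t)).trans (hd _)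
  · rw [Fintype.card_fun, Fintype.card_fin, Nat.cast_pow, Real.log_pow, mul_div_assoc,
      ENNReal.ofReal_mul (Nat.cast_nonneg _), ENNReal.ofReal_natCast]

theorem tendsto_natCast_add_div (L : ℕ) :
    Tendsto (fun n : ℕ => ((n + L : ℕ) : ℝ≥0∞) / n) atTop (𝓝 1) := by
  have hlim : Tendsto (fun n : ℕ => 1 + (L : ℝ≥0∞) / n) atTop (𝓝 1) := by
    simpa using (ENNReal.Tendsto.const_div ENNReal.tendsto_nat_nhds_top
      (Or.inr (ENNReal.natCast_ne_top L))).const_add 1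
  refine hlim.congr' ?_
  filter_upwards [eventually_ne_atTop 0] with n hn
  rw [Nat.cast_add, ENNReal.add_div, ENNReal.div_self (by simpa using hn) (by simp)]

theorem tendsto_log_const_mul_div_log {C : ℝ} (hC : C ≠ 0) :
    Tendsto (fun δ => Real.log (C * δ) / Real.log δ) (𝓝[>] 0) (𝓝 1) := by
  have hlim : Tendsto (fun δ => Real.log C / Real.log δ + 1) (𝓝[>] 0) (𝓝 1) := by
    simpa using (Real.tendsto_log_nhdsGT_zero.const_div_atBot (Real.log C)).add_const 1
  refine hlim.congr' ?_
  filter_upwards [Ioo_mem_nhdsGT one_pos] with δ hδ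
  rw [Real.log_mul hC hδ.1.ne', add_div, div_self (Real.log_neg hδ.1 hδ.2).ne]

theorem le_lowerBoxDim_of_eventually_le {C : ℝ} (hC : 0 < C) {b : ℝ≥0∞}
    (h : ∀ᶠ δ in 𝓝[>] 0,
      b ≤ ENNReal.ofReal (Real.log (boxNumber M δ) / -Real.log (C * δ))) :
    b ≤ lowerBoxDim M := by
  have hlim : Tendsto (fun δ => b * ENNReal.ofReal (Real.log (C * δ) / Real.log δ)) (𝓝[>] 0)
      (𝓝 b) := by
    simpa using ENNReal.Tendsto.const_mul
      (ENNReal.tendsto_ofReal (tendsto_log_const_mul_div_log hC.ne')) (by simp)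
  have hsmall : ∀ᶠ δ in 𝓝[>] (0 : ℝ), C * δ < 1 :=
    ((continuous_const_mul C).tendsto' 0 0 (mul_zero C) |>.mono_left
      nhdsWithin_le_nhds).eventually_lt_const one_pos
  rw [← hlim.liminf_eq]
  refine liminf_le_liminf ?_
  filter_upwards [h, hsmall, Ioo_mem_nhdsGT one_pos] with δ hb hCδ hδ
  have hlog : Real.log (C * δ) < 0 := Real.log_neg (mul_pos hC hδ.1) hCδ
  have hlog' : Real.log δ < 0 := Real.log_neg hδ.1 hδ.2
  calc b * ENNReal.ofReal (Real.log (C * δ) / Real.log δ)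
      ≤ ENNReal.ofReal (Real.log (boxNumber M δ) / -Real.log (C * δ)) *
          ENNReal.ofReal (Real.log (C * δ) / Real.log δ) := by gcongr
    _ = ENNReal.ofReal (Real.log (boxNumber M δ) / -Real.log δ) := by
        rw [← ENNReal.ofReal_mul' (div_nonneg_of_nonpos hlog.le hlog'.le)]
        congr 1
        field_simp [hlog.ne]

end UpperBound

section Shift

variable {K M X : Type*}

theorem dynDist_le {ρ : X → X → ℝ} {f : X → X} {n : ℕ} {x y : X} {r : ℝ} (hr : 0 ≤ r)
    (h : ∀ i < n, ρ (f^[i] x) (f^[i] y) ≤ r) : dynDist ρ f n x y ≤ r :=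
  Real.iSup_le (fun i => h i i.2) hr

theorem shift_iterate [AddMonoidWithOne K] (x : K → M) (i : ℕ) (k : K) :
    shift^[i] x k = x (k + i) := by
  induction i generalizing x with
  | zero => simp
  | succ i ih => simp [ih, shift, add_assoc, Nat.cast_succ]

theorem exists_card_image₂_add_natCast_le [AddMonoidWithOne K] [DecidableEq K]
    (hK : ∀ j : K, ∃ p q : ℕ, j + p = q) (S : Finset K) :
    ∃ L, ∀ n, (Finset.image₂ (fun j (i : ℕ) => j + (i : K)) S (.range n)).card ≤ n + L := by
  choose p q hpq using hK
  refine ⟨S.sup q + ∑ j ∈ S, p j, fun n => ?_⟩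
  have hsub : Finset.image₂ (fun j (i : ℕ) => j + (i : K)) S (.range n) ⊆
      (Finset.range (n + S.sup q)).image Nat.cast ∪
        S.biUnion fun j => (Finset.range (p j)).image fun i : ℕ => j + (i : K) := by
    refine Finset.image₂_subset_iff.2 fun j hj i hi => ?_
    rw [Finset.mem_union, Finset.mem_biUnion]
    rcases lt_or_ge i (p j) with hlt | hge
    · exact .inr ⟨j, hj, Finset.mem_image_of_mem _ (Finset.mem_range.2 hlt)⟩
    · obtain ⟨l, rfl⟩ := Nat.exists_eq_add_of_le hge
      refine .inl (Finset.mem_image.2 ⟨q j + l, ?_, ?_⟩)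
      · have := Finset.le_sup (f := q) hj
        rw [Finset.mem_range] at hi ⊢
        lia
      · rw [Nat.cast_add, Nat.cast_add, ← hpq, add_assoc]
  calc _ ≤ _ := Finset.card_le_card hsub
    _ ≤ (n + S.sup q) + ∑ j ∈ S, p j := by
        refine (Finset.card_union_le _ _).trans (add_le_add ?_ ?_)
        · exact Finset.card_image_le.trans_eq (Finset.card_range _)
        · exact Finset.card_biUnion_le.trans <| Finset.sum_le_sum fun j _ =>
            Finset.card_image_le.trans_eq (Finset.card_range _)
    _ = n + (S.sup q + ∑ j ∈ S, p j) := add_assoc _ _ _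

theorem lowerMeanDimH_le_upperMeanDimH (ρ : X → X → ℝ) (f : X → X) :
    lowerMeanDimH ρ f ≤ upperMeanDimH ρ f :=
  iSup₂_mono fun _ _ => liminf_le_limsup

variable [MetricSpace M]

theorem limsup_dimHScale_shift_le [CompactSpace M] [AddMonoidWithOne K]
    (hK : ∀ j : K, ∃ p q : ℕ, j + p = q) {ρ : (K → M) → (K → M) → ℝ} {S : Finset K} {δ r ε : ℝ}
    (hδ : 0 < δ) (hr0 : 0 < r) (hr1 : r < 1) (hrε : r < ε)
    (hS : ∀ x y, (∀ j ∈ S, dist (x j) (y j) ≤ δ) → ρ x y ≤ r) :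
    limsup (fun n : ℕ => dimHScale (dynDist ρ shift n) ε / n) atTop ≤
      ENNReal.ofReal (Real.log (boxNumber M δ) / -Real.log r) := by
  classical
  set b := ENNReal.ofReal (Real.log (boxNumber M δ) / -Real.log r)
  obtain ⟨L, hL⟩ := exists_card_image₂_add_natCast_le hK S
  have hscale : ∀ n : ℕ, dimHScale (dynDist ρ shift n) ε ≤ (n + L : ℕ) * b := fun n => by
    set W := Finset.image₂ (fun j (i : ℕ) => j + (i : K)) S (.range n)
    refine (dimHScale_le_card_mul_boxNumber (fun x (t : W) => x t) hδ hr0 hr1 hrε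
      fun x y hxy => dynDist_le hr0.le fun i hi => hS _ _ fun j hj => ?_).trans ?_
    · rw [shift_iterate, shift_iterate]
      exact hxy ⟨j + i, Finset.mem_image₂_of_mem hj (Finset.mem_range.2 hi)⟩
    · rw [Fintype.card_coe]
      gcongr
      exact hL n
  have hlim : Tendsto (fun n : ℕ => ((n + L : ℕ) : ℝ≥0∞) / n * b) atTop (𝓝 b) := by
    simpa using ENNReal.Tendsto.mul_const (tendsto_natCast_add_div L) (Or.inl one_ne_zero)
  calc _ ≤ limsup (fun n : ℕ => ((n + L : ℕ) : ℝ≥0∞) / n * b) atTop :=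
        limsup_le_limsup <| Eventually.of_forall fun n =>
          (ENNReal.div_le_div_right (hscale n) _).trans_eq ENNReal.mul_div_right_comm
    _ = b := hlim.limsup_eq

/-- The distance `∑ j, a j * d(xⱼ, yⱼ)` on `M^K`, the common form of `seqDist` and `biseqDist`.
It is meant for `a` nonnegative and summable and `M` bounded; otherwise the series may diverge and
`tsum` returns `0`. -/
noncomputable def weightedDist (a : K → ℝ) (x y : K → M) : ℝ :=
  ∑' j, a j * dist (x j) (y j)

variable {a : K → ℝ}

theorem summable_weightedDist [BoundedSpace M] (ha0 : ∀ j, 0 ≤ a j) (ha : Summable a)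
    (x y : K → M) : Summable fun j => a j * dist (x j) (y j) := by
  refine Summable.of_nonneg_of_le (fun j => mul_nonneg (ha0 j) dist_nonneg) (fun j => ?_)
    (ha.mul_right (Metric.diam (Set.univ : Set M)))
  exact mul_le_mul_of_nonneg_left
    (Metric.dist_le_diam_of_mem (Bornology.IsBounded.all _) trivial trivial) (ha0 j)

theorem exists_finset_weightedDist_le [BoundedSpace M] (ha0 : ∀ j, 0 ≤ a j) (ha : Summable a)
    {δ : ℝ} (hδ : 0 < δ) : ∃ S : Finset K, ∀ x y : K → M, (∀ j ∈ S, dist (x j) (y j) ≤ δ) →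
    weightedDist a x y ≤ (∑' j, a j + 1) * δ := by
  set D := Metric.diam (Set.univ : Set M)
  have htail : Tendsto (fun S : Finset K => (∑' j : {j // j ∉ S}, a j) * D) atTop (𝓝 0) := by
    simpa using (tendsto_tsum_compl_atTop_zero a).mul_const D
  obtain ⟨S, hS⟩ := (htail.eventually_lt_const hδ).exists
  refine ⟨S, fun x y hxy => ?_⟩
  have hsum := summable_weightedDist ha0 ha x y
  calc weightedDist a x y
      = ∑ j ∈ S, a j * dist (x j) (y j) + ∑' j : {j // j ∉ S}, a j * dist (x j) (y j) :=
        (hsum.sum_add_tsum_subtype_compl S).symm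
    _ ≤ ∑ j ∈ S, a j * δ + ∑' j : {j // j ∉ S}, a j * D := by
        refine add_le_add
          (Finset.sum_le_sum fun j hj => mul_le_mul_of_nonneg_left (hxy j hj) (ha0 j))
          ((hsum.subtype _).tsum_le_tsum (fun j => ?_) ((ha.mul_right D).subtype _))
        exact mul_le_mul_of_nonneg_left
          (Metric.dist_le_diam_of_mem (Bornology.IsBounded.all _) trivial trivial) (ha0 j)
    _ ≤ (∑' j, a j) * δ + δ := by
        rw [← Finset.sum_mul, tsum_mul_right]
        gcongr
        exact ha.sum_le_tsum S fun j _ => ha0 j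
    _ = (∑' j, a j + 1) * δ := by ring

theorem dimH_le_lowerMeanDimH_shift [CompactSpace M] [AddMonoidWithOne K] [CharZero K]
    (ha0 : ∀ j, 0 ≤ a j) (ha : Summable a) (h0 : 0 < a 0) :
    dimH (Set.univ : Set M) ≤ lowerMeanDimH (weightedDist a) (shift : (K → M) → K → M) := by
  rcases isEmpty_or_nonempty M
  · simp [Set.univ_eq_empty_iff.2 ‹_›]
  refine dimH_le_lowerMeanDimH (c := ⟨a 0, ha0 0⟩) (p := fun x => x 0) h0 (fun x y => ?_)
    fun n z => ?_
  · exact (summable_weightedDist ha0 ha x y).le_tsum 0 fun j _ => mul_nonneg (ha0 j) dist_nonneg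
  · have hinj : Function.Injective fun i : Fin n => (i : K) :=
      Nat.cast_injective.comp Fin.val_injective
    obtain ⟨m⟩ := ‹Nonempty M›
    refine ⟨Function.extend (fun i : Fin n => (i : K)) z fun _ => m, funext fun i => ?_⟩
    simpa [shift_iterate] using hinj.extend_apply z (fun _ => m) i

theorem upperMeanDimH_shift_le_lowerBoxDim [CompactSpace M] [AddMonoidWithOne K]
    (ha0 : ∀ j, 0 ≤ a j) (ha : Summable a) (hK : ∀ j : K, ∃ p q : ℕ, j + p = q) :
    upperMeanDimH (weightedDist a) (shift : (K → M) → K → M) ≤ lowerBoxDim M := by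
  have hC : 0 < ∑' j, a j + 1 := by linarith [(tsum_nonneg ha0 : 0 ≤ ∑' j, a j)]
  have hlim : Tendsto (fun δ => (∑' j, a j + 1) * δ) (𝓝[>] 0) (𝓝 0) :=
    ((continuous_const_mul _).tendsto' 0 0 (mul_zero _)).mono_left nhdsWithin_le_nhds
  refine iSup₂_le fun ε hε => le_lowerBoxDim_of_eventually_le hC ?_
  filter_upwards [self_mem_nhdsWithin, hlim.eventually_lt_const one_pos,
    hlim.eventually_lt_const hε] with δ hδ hr1 hrε
  obtain ⟨S, hS⟩ := exists_finset_weightedDist_le (M := M) ha0 ha hδ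
  exact limsup_dimHScale_shift_le hK hδ (mul_pos hC hδ) hr1 hrε hS

end Shift

theorem summable_one_div_two_pow_natAbs : Summable fun j : ℤ => (1 : ℝ) / 2 ^ j.natAbs := by
  refine Summable.of_nat_of_neg ?_ ?_ <;> simpa using summable_geometric_two

end MeanHausdorff

open MeanHausdorff in
theorem mainTheorem3_general {M K : Type*} [MetricSpace M] [CompactSpace M] [AddMonoidWithOne K]
    [CharZero K] (hK : ∀ j : K, ∃ p q : ℕ, j + p = q) {a : K → ℝ} (ha0 : ∀ j, 0 ≤ a j)
    (ha : Summable a) (h0 : 0 < a 0) :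
    dimH (Set.univ : Set M) ≤ lowerMeanDimH (weightedDist (M := M) a) shift ∧
      lowerMeanDimH (weightedDist (M := M) a) shift ≤
        upperMeanDimH (weightedDist (M := M) a) shift ∧
      upperMeanDimH (weightedDist (M := M) a) shift ≤ lowerBoxDim M :=
  ⟨dimH_le_lowerMeanDimH_shift ha0 ha h0, lowerMeanDimH_le_upperMeanDimH _ _,
    upperMeanDimH_shift_le_lowerBoxDim ha0 ha hK⟩

theorem mainTheorem3 (M : Type*) [MetricSpace M] [CompactSpace M] [Nonempty M] :
    (dimH (Set.univ : Set M)
          ≤ MeanHausdorff.lowerMeanDimH (MeanHausdorff.seqDist (M := M)) MeanHausdorff.shift ∧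
      MeanHausdorff.lowerMeanDimH (MeanHausdorff.seqDist (M := M)) MeanHausdorff.shift
          ≤ MeanHausdorff.upperMeanDimH (MeanHausdorff.seqDist (M := M)) MeanHausdorff.shift ∧
      MeanHausdorff.upperMeanDimH (MeanHausdorff.seqDist (M := M)) MeanHausdorff.shift
          ≤ MeanHausdorff.lowerBoxDim M) ∧
    (dimH (Set.univ : Set M)
          ≤ MeanHausdorff.lowerMeanDimH (MeanHausdorff.biseqDist (M := M)) MeanHausdorff.shift ∧
      MeanHausdorff.lowerMeanDimH (MeanHausdorff.biseqDist (M := M)) MeanHausdorff.shift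
          ≤ MeanHausdorff.upperMeanDimH (MeanHausdorff.biseqDist (M := M)) MeanHausdorff.shift ∧
      MeanHausdorff.upperMeanDimH (MeanHausdorff.biseqDist (M := M)) MeanHausdorff.shift
          ≤ MeanHausdorff.lowerBoxDim M) := by
  constructor
  · exact mainTheorem3_general (fun j => ⟨0, j, by simp⟩) (fun j => by positivity)
      (by simpa using summable_geometric_two) (by simp)
  · exact mainTheorem3_general (fun j => ⟨(-j).toNat, j.toNat, by lia⟩) (fun j => by positivity)
      MeanHausdorff.summable_one_div_two_pow_natAbs (by simp)
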